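/- Let $d\in\mathbb N$. Logarithms are to base $2$. A state on $\mathbb C^d$ is a positive semidefinite $d\times d$ complex matrix of trace one, $H(\rho)=-\operatorname{tr}[\rho\log\rho]$ is its von Neumann entropy, and $d_{\mathrm{tr}}(\rho,\sigma)=\tfrac12\|\rho-\sigma\|_1$ is the trace distance, with $d_{\mathrm{tr}}(\rho',S)=\inf_{\tau\in S}d_{\mathrm{tr}}(\rho',\tau)$ for a set $S$. Write $\rho\succeq\sigma$ if $\sigma=\sum_{i=1}^m p_iU_i\rho U_i^\dagger$ for finitely many unitaries $U_i$ and probabilities $p_i$. For $n\ge 1$ and a state $\rho$ on $\mathbb C^d$ let $$S_n(\rho)=\Big\{\tfrac1n\sum_{i=1}^n\sigma_{\{i\}}\ \Big|\ \rho^{\otimes n}\succeq\sigma,\ \sigma\ge 0,\ \operatorname{tr}\sigma=1\Big\},$$ where $\sigma_{\{i\}}=\operatorname{tr}_{\{1,\dots,n\}\setminus i}[\sigma]$ is the marginal of $\sigma$ on the $i$-th tensor factor. Typicality: for all $\delta>0$ and $\epsilon>0$ there is an integer $n_\epsilon\ge 1$, depending only on $d$, $\delta$ and $\epsilon$, and given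 for $\epsilon<1$ by $$n_\epsilon=\left\lceil\frac{2\log^2(d+3)}{\delta^2}\log\frac1\epsilon\right\rceil,$$ such that for all states $\rho,\rho'$ on $\mathbb C^d$ with $H(\rho')>H(\rho)+2\delta$, $$d_{\mathrm{tr}}\big(\rho',S_{n_\epsilon}(\rho)\big)\le\epsilon .$$ -/

import Mathlib

open scoped Matrix ENNReal ComplexOrder

noncomputable section

namespace QTypicality

/-- A state (density matrix): a positive semidefinite matrix of trace one. -/
def IsState {ι : Type*} [Fintype ι] (ρ : Matrix ι ι ℂ) : Prop :=
  ρ.PosSemidef ∧ ρ.trace = 1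

/-- The von Neumann entropy `-tr (ρ log ρ)`, with the logarithm to base 2 taken by functional
calculus (since `Real.logb 2 0 = 0`, zero eigenvalues contribute nothing). -/
def entropy {ι : Type*} [Fintype ι] [DecidableEq ι] (ρ : Matrix ι ι ℂ) : ℝ :=
  -(ρ * cfc (Real.logb 2) ρ).trace.re

/-- The trace norm `‖A‖₁ = tr √(A† A)`. -/
def traceNorm {ι : Type*} [Fintype ι] [DecidableEq ι] (A : Matrix ι ι ℂ) : ℝ :=
  (cfc Real.sqrt (Aᴴ * A)).trace.re

/-- The trace distance `‖ρ - σ‖₁ / 2`. -/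
def traceDist {ι : Type*} [Fintype ι] [DecidableEq ι] (ρ σ : Matrix ι ι ℂ) : ℝ :=
  traceNorm (ρ - σ) / 2

/-- The trace distance from a matrix to a set of matrices, as an infimum in `[0, ∞]`
(so the distance to the empty set is `∞`). -/
def traceDistToSet {ι : Type*} [Fintype ι] [DecidableEq ι]
    (ρ : Matrix ι ι ℂ) (S : Set (Matrix ι ι ℂ)) : ℝ≥0∞ :=
  ⨅ σ ∈ S, ENNReal.ofReal (traceDist ρ σ)

/-- `Majorizes ρ σ`, i.e. `ρ ⪰ σ`: `σ` is a finite convex combination of unitary conjugates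
of `ρ`. -/
def Majorizes {ι : Type*} [Fintype ι] [DecidableEq ι] (ρ σ : Matrix ι ι ℂ) : Prop :=
  ∃ (m : ℕ) (U : Fin m → Matrix ι ι ℂ) (p : Fin m → ℝ),
    (∀ i, U i ∈ Matrix.unitaryGroup ι ℂ) ∧ (∀ i, 0 ≤ p i) ∧ ∑ i, p i = 1 ∧
      σ = ∑ i, (p i : ℂ) • (U i * ρ * (U i)ᴴ)

/-- The tensor power `ρ^{⊗ n}` on `(ℂ^d)^{⊗ n}`, whose standard product basis is indexed by
`Fin n → Fin d`. -/
def tensorPower {d : ℕ} (ρ : Matrix (Fin d) (Fin d) ℂ) (n : ℕ) :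
    Matrix (Fin n → Fin d) (Fin n → Fin d) ℂ :=
  fun x y => ∏ i, ρ (x i) (y i)

/-- The marginal of `σ` on site `i`, obtained by tracing out all other sites: the `(a, b)` entry
is the sum of the entries `σ x y` over all `x`, `y` with `x i = a`, `y i = b` and `x j = y j` at
every other site `j`. -/
def marginal {d n : ℕ} (σ : Matrix (Fin n → Fin d) (Fin n → Fin d) ℂ) (i : Fin n) :
    Matrix (Fin d) (Fin d) ℂ :=
  fun a b => ∑ x : Fin n → Fin d with x i = a, σ x (Function.update x i b)

/-- `S_n(ρ)`: the averages over the `n` sites of the single-site marginals of states majorized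
by `ρ^{⊗ n}`. -/
def marginalSet {d : ℕ} (n : ℕ) (ρ : Matrix (Fin d) (Fin d) ℂ) :
    Set (Matrix (Fin d) (Fin d) ℂ) :=
  {τ | ∃ σ : Matrix (Fin n → Fin d) (Fin n → Fin d) ℂ,
    Majorizes (tensorPower ρ n) σ ∧ IsState σ ∧ τ = (1 / (n : ℂ)) • ∑ i, marginal σ i}

end QTypicality

end

/-! Diagonalize `ρ` with spectrum `p` and `ρ'` with spectrum `q`; only these distributions matter.
If a doubly stochastic `D` sends `p^n` to some `s`, then by Birkhoff's theorem `ρ^{⊗n}` majorizes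
the state with spectrum `s` in the product eigenbasis of `ρ'`. Its marginals are diagonal in the
eigenbasis of `ρ'`, and their average is at least as close to `ρ'` as `s` is to `q^n`.

A good `D` exists whenever a typical probability under `q^n` is smaller than a typical one under
`p^n`: the error is the `crossing` probability that independent `x ∼ p^n`, `y ∼ q^n` satisfy `p^n x
< q^n y` (`exists_doublyStochastic_sum_abs_sub_le`).

A Chernoff bound gives `crossing ≤ (∑ p^(1-s) * ∑ q^(1+s))^n`. To first order in `s` the logarithm
of the base is `s (H(p) - H(q))`, in nats. The second-order terms are controlled by second moments
of the surprisal, of order `log² (d+3)`, so a suitable `s` gives decay at rate `(δ / log (d+3))²`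
(`crossing_prodDist_le_exp`). -/

noncomputable section

namespace QTypicality

/-! ### Majorization between probability vectors -/

/-- A doubly substochastic matrix is dominated entrywise by a doubly stochastic one. -/
lemma exists_mem_doublyStochastic_ge {ι : Type*} [Fintype ι] [DecidableEq ι]
    (D : Matrix ι ι ℝ) (h0 : ∀ i j, 0 ≤ D i j) (hr : ∀ i, ∑ j, D i j ≤ 1)
    (hc : ∀ j, ∑ i, D i j ≤ 1) :
    ∃ D' ∈ doublyStochastic ℝ ι, ∀ i j, D i j ≤ D' i j := by
  set a : ι → ℝ := fun i => 1 - ∑ j, D i j with ha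
  set b : ι → ℝ := fun j => 1 - ∑ i, D i j with hb
  have ha0 : ∀ i, 0 ≤ a i := fun i => sub_nonneg.2 (hr i)
  have hb0 : ∀ i, 0 ≤ b i := fun i => sub_nonneg.2 (hc i)
  have hab : ∑ i, a i = ∑ j, b j := by
    simp only [ha, hb, Finset.sum_sub_distrib]
    rw [Finset.sum_comm]
  set t : ℝ := ∑ i, a i with ht
  have ht0 : 0 ≤ t := Finset.sum_nonneg fun i _ => ha0 i
  -- If `t = 0`, all deficits vanish, which agrees with division by zero giving zero.
  have hA : ∀ i, a i * t / t = a i := by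
    intro i
    rcases ht0.eq_or_lt with h | h
    · have : a i = 0 := (Finset.sum_eq_zero_iff_of_nonneg fun i _ => ha0 i).1 (ht ▸ h.symm) i
        (Finset.mem_univ i)
      simp [this]
    · field_simp
  have hB : ∀ i, t * b i / t = b i := by
    intro i
    rcases ht0.eq_or_lt with h | h
    · have : b i = 0 := (Finset.sum_eq_zero_iff_of_nonneg fun i _ => hb0 i).1
        (hab ▸ h.symm) i (Finset.mem_univ i)
      simp [this]
    · field_simp
  -- The row deficits `a` and column deficits `b` have the same total `t`, so the rank-one matrix `a
  -- i * b j / t` fills both.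
  refine ⟨Matrix.of fun i j => D i j + a i * b j / t, ?_, ?_⟩
  · refine mem_doublyStochastic_iff_sum.2 ⟨fun i j => ?_, fun i => ?_, fun j => ?_⟩
    · have := h0 i j
      have := ha0 i
      have := hb0 j
      simp only [Matrix.of_apply]
      positivity
    · simp only [Matrix.of_apply]
      rw [Finset.sum_add_distrib, ← Finset.sum_div, ← Finset.mul_sum, ← hab, hA]
      simp [ha]
    · simp only [Matrix.of_apply]
      rw [Finset.sum_add_distrib, ← Finset.sum_div, ← Finset.sum_mul, hB]
      simp [hb]
  · intro i j
    have := ha0 i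
    have := hb0 j
    have : 0 ≤ a i * b j / t := by positivity
    simp only [Matrix.of_apply]
    linarith

/-- The probability that independent `x ∼ r` and `y ∼ q` satisfy `r x < q y`. -/
def crossing {ι : Type*} [Fintype ι] (r q : ι → ℝ) : ℝ :=
  ∑ y, ∑ x, if r x < q y then r x * q y else 0

lemma crossing_le_one {ι : Type*} [Fintype ι] {r q : ι → ℝ} (hr : r ∈ stdSimplex ℝ ι)
    (hq : q ∈ stdSimplex ℝ ι) : crossing r q ≤ 1 := by
  calc crossing r q ≤ ∑ y, ∑ x, r x * q y := by
        refine Finset.sum_le_sum fun y _ => Finset.sum_le_sum fun x _ => ?_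
        have := mul_nonneg (hr.1 x) (hq.1 y)
        split_ifs <;> linarith
    _ = 1 := by
        rw [Finset.sum_comm, ← Finset.sum_mul_sum, hr.2, hq.2, one_mul]

/-- The distance from `q` to the distributions majorized by `r` is bounded by a crossing
probability. -/
lemma exists_doublyStochastic_sum_abs_sub_le {ι : Type*} [Fintype ι] [DecidableEq ι]
    {r q : ι → ℝ} (hr : r ∈ stdSimplex ℝ ι) (hq : q ∈ stdSimplex ℝ ι) :
    ∃ D ∈ doublyStochastic ℝ ι, ∑ y, |q y - (D *ᵥ r) y| ≤ 2 * crossing r q := by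
  -- Spread the mass `q y` over the `x` with `r x ≥ q y`. Rows sum to at most `∑ r`, because each
  -- nonzero entry is at most `r x`; columns sum to at most `∑ q`.
  obtain ⟨D, hD, hle⟩ := exists_mem_doublyStochastic_ge
    (Matrix.of fun y x => if q y ≤ r x then q y else 0)
    (fun y x => by
      have := hq.1 y
      simp only [Matrix.of_apply]
      split_ifs <;> simp [this])
    (fun y => by
      simp only [Matrix.of_apply]
      calc ∑ x, (if q y ≤ r x then q y else 0) ≤ ∑ x, r x :=
            Finset.sum_le_sum fun x _ => by
              have := hr.1 x
              split_ifs <;> linarith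
        _ ≤ 1 := hr.2.le)
    (fun x => by
      simp only [Matrix.of_apply]
      calc ∑ y, (if q y ≤ r x then q y else 0) ≤ ∑ y, q y :=
            Finset.sum_le_sum fun y _ => by
              have := hq.1 y
              split_ifs <;> linarith
        _ ≤ 1 := hq.2.le)
  simp only [Matrix.of_apply] at hle
  refine ⟨D, hD, ?_⟩
  have hD' := mem_doublyStochastic_iff_sum.1 hD
  have hsum : ∑ y, (D *ᵥ r) y = 1 := by
    simp only [Matrix.mulVec, dotProduct]
    rw [Finset.sum_comm, ← hr.2]
    refine Finset.sum_congr rfl fun x _ => ?_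
    rw [← Finset.sum_mul, hD'.2.2 x, one_mul]
  set e : ι → ℝ := fun y => ∑ x, if r x < q y then r x * q y else 0 with he
  have he0 : ∀ y, 0 ≤ e y := fun y => Finset.sum_nonneg fun x _ => by
    have := mul_nonneg (hr.1 x) (hq.1 y)
    split_ifs <;> linarith
  have hkey : ∀ y, q y - (D *ᵥ r) y ≤ e y := by
    intro y
    have h1 : q y = ∑ x, q y * r x := by rw [← Finset.mul_sum, hr.2, mul_one]
    rw [h1]
    simp only [Matrix.mulVec, dotProduct, he]
    rw [← Finset.sum_sub_distrib]
    refine Finset.sum_le_sum fun x _ => ?_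
    have h2 := mul_le_mul_of_nonneg_right (hle y x) (hr.1 x)
    have h3 := mul_nonneg (hD'.1 y x) (hr.1 x)
    by_cases h : r x < q y
    · rw [if_pos h]; linarith
    · rw [if_pos (not_lt.1 h)] at h2
      rw [if_neg h]; linarith
  -- Both vectors have total mass one, so bounding the positive part of the difference bounds half
  -- the `ℓ¹` norm.
  calc ∑ y, |q y - (D *ᵥ r) y| ≤ ∑ y, (2 * e y - (q y - (D *ᵥ r) y)) :=
        Finset.sum_le_sum fun y _ => abs_le.2 ⟨by linarith [he0 y], by linarith [hkey y]⟩
    _ = 2 * crossing r q := by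
        rw [Finset.sum_sub_distrib, Finset.sum_sub_distrib, hq.2, hsum, ← Finset.mul_sum]
        simp [crossing, he]

/-! ### Product distributions and the Chernoff bound -/

/-- The `n`-fold product of a distribution. -/
def prodDist {α : Type*} (p : α → ℝ) (n : ℕ) : (Fin n → α) → ℝ := fun x => ∏ i, p (x i)

lemma sum_prodDist {α : Type*} [Fintype α] (p : α → ℝ) (n : ℕ) :
    ∑ x, prodDist p n x = (∑ a, p a) ^ n := by
  classical
  have := Finset.prod_univ_sum (fun _ : Fin n => (Finset.univ : Finset α)) (fun _ a => p a)
  simpa [prodDist] using this.symm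

lemma prodDist_mem_stdSimplex {α : Type*} [Fintype α] {p : α → ℝ} (hp : p ∈ stdSimplex ℝ α)
    (n : ℕ) : prodDist p n ∈ stdSimplex ℝ (Fin n → α) :=
  ⟨fun x => Finset.prod_nonneg fun i _ => hp.1 (x i), by rw [sum_prodDist, hp.2, one_pow]⟩

/-- Chernoff bound for the crossing probability of product distributions. -/
lemma crossing_prodDist_le {α : Type*} [Fintype α] {p q : α → ℝ} (hp : ∀ a, 0 ≤ p a)
    (hq : ∀ a, 0 ≤ q a) (n : ℕ) {s : ℝ} (hs : 0 ≤ s) :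
    crossing (prodDist p n) (prodDist q n) ≤
      ((∑ a, p a ^ (1 - s)) * ∑ a, q a ^ (1 + s)) ^ n := by
  have hpow : ∀ (f : α → ℝ) (hf : ∀ a, 0 ≤ f a) (u : ℝ),
      (∑ a, f a ^ u) ^ n = ∑ x, prodDist f n x ^ u := by
    intro f hf u
    rw [← sum_prodDist]
    refine Finset.sum_congr rfl fun x _ => ?_
    simp only [prodDist]
    rw [Real.finsetProd_rpow _ _ fun i _ => hf (x i)]
  rw [mul_pow, hpow p hp, hpow q hq, Finset.sum_mul_sum, Finset.sum_comm]
  refine Finset.sum_le_sum fun y _ => Finset.sum_le_sum fun x _ => ?_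
  have hr0 : 0 ≤ prodDist p n x := Finset.prod_nonneg fun i _ => hp (x i)
  have hQ0 : 0 ≤ prodDist q n y := Finset.prod_nonneg fun i _ => hq (y i)
  generalize prodDist p n x = r at hr0 ⊢
  generalize prodDist q n y = Q at hQ0 ⊢
  have hnn := mul_nonneg (Real.rpow_nonneg hr0 (1 - s)) (Real.rpow_nonneg hQ0 (1 + s))
  split_ifs with h
  · rcases hr0.eq_or_lt with h0 | h0
    · rw [← h0, zero_mul]
      rwa [← h0] at hnn
    · have hQ : 0 < Q := h0.trans h
      -- Chernoff: on the event `r < Q` the factor `(Q / r) ^ s` is at least one.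
      calc r * Q = r ^ (1 - s) * r ^ s * Q := by
            rw [← Real.rpow_add h0, sub_add_cancel, Real.rpow_one]
        _ ≤ r ^ (1 - s) * Q ^ s * Q := by gcongr
        _ = r ^ (1 - s) * Q ^ (1 + s) := by
            rw [Real.rpow_add hQ, Real.rpow_one]; ring
  · exact hnn

/-! ### Moment estimates and the decay rate -/

/-- Exponential moments of a distribution on at most `D` points. -/
lemma sum_rpow_one_sub_le {α : Type*} [Fintype α] {p : α → ℝ} (hp : p ∈ stdSimplex ℝ α)
    {D : ℝ} (hD : 0 < D) (hcard : (Fintype.card α : ℝ) ≤ D) {κ : ℝ} (h0 : 0 ≤ κ) (h1 : κ ≤ 1) :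
    ∑ a, p a ^ (1 - κ) ≤ D ^ κ := by
  -- Weighted AM-GM against the constant weight `1 / D`, whose total is at most one.
  have hterm : ∀ a, p a ^ (1 - κ) * D⁻¹ ^ κ ≤ (1 - κ) * p a + κ * D⁻¹ := fun a =>
    Real.geom_mean_le_arith_mean2_weighted (by linarith) h0 (hp.1 a) (by positivity) (by ring)
  have hsum : (∑ a, p a ^ (1 - κ)) * D⁻¹ ^ κ ≤ 1 := by
    rw [Finset.sum_mul]
    refine (Finset.sum_le_sum fun a _ => hterm a).trans ?_
    rw [Finset.sum_add_distrib, ← Finset.mul_sum, hp.2, Finset.sum_const, Finset.card_univ,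
      nsmul_eq_mul]
    have : (Fintype.card α : ℝ) * D⁻¹ ≤ 1 := by
      rw [← div_eq_mul_inv]
      exact div_le_one_of_le₀ hcard hD.le
    nlinarith
  rw [Real.inv_rpow hD.le, ← div_eq_mul_inv, div_le_one (by positivity)] at hsum
  exact hsum

/-- Square `y ≤ exp (y - 1)` at `y = -log x / (2 M)`. The exponent `1 / M` is such that, on at most
`exp M` points, the extra tilt costs only a factor `e`. -/
lemma log_sq_le_mul_rpow {x M : ℝ} (hx : 0 < x) (hx1 : x ≤ 1) (hM : 0 < M) :
    Real.log x ^ 2 ≤ 4 * M ^ 2 * Real.exp (-2) * x ^ (-(1 / M)) := by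
  have hl : Real.log x ≤ 0 := Real.log_nonpos hx.le hx1
  have h := Real.add_one_le_exp (-Real.log x / (2 * M) - 1)
  rw [sub_add_cancel] at h
  have h0 : 0 ≤ -Real.log x / (2 * M) := div_nonneg (by linarith) (by linarith)
  have h2 := pow_le_pow_left₀ h0 h 2
  rw [← Real.exp_nat_mul] at h2
  have he : Real.exp (((2 : ℕ) : ℝ) * (-Real.log x / (2 * M) - 1)) =
      Real.exp (-2) * x ^ (-(1 / M)) := by
    rw [Real.rpow_def_of_pos hx, ← Real.exp_add]
    congr 1
    push_cast
    field_simp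
    ring
  rw [he] at h2
  calc Real.log x ^ 2 = 4 * M ^ 2 * (-Real.log x / (2 * M)) ^ 2 := by field_simp; ring
    _ ≤ 4 * M ^ 2 * (Real.exp (-2) * x ^ (-(1 / M))) := by gcongr
    _ = _ := by ring

/-- Second moment of the tilted surprisal. -/
lemma sum_rpow_mul_log_sq_le {α : Type*} [Fintype α] {p : α → ℝ} (hp : p ∈ stdSimplex ℝ α)
    {M : ℝ} (hM : 0 < M) (hcard : (Fintype.card α : ℝ) ≤ Real.exp M) {s : ℝ} (h0 : 0 ≤ s)
    (h1 : s + 1 / M < 1) :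
    ∑ a, p a ^ (1 - s) * Real.log (p a) ^ 2 ≤ 4 * M ^ 2 * Real.exp (s * M - 1) := by
  have hM' : 0 < 1 / M := by positivity
  calc ∑ a, p a ^ (1 - s) * Real.log (p a) ^ 2
      ≤ ∑ a, 4 * M ^ 2 * Real.exp (-2) * p a ^ (1 - (s + 1 / M)) := by
        refine Finset.sum_le_sum fun a _ => ?_
        have hp1 : p a ≤ 1 :=
          hp.2 ▸ Finset.single_le_sum (fun b _ => hp.1 b) (Finset.mem_univ a)
        rcases (hp.1 a).eq_or_lt with h | h
        · rw [← h, Real.log_zero, Real.zero_rpow (by linarith)]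
          have : (0 : ℝ) ≤ 0 ^ (1 - (s + 1 / M)) := Real.rpow_nonneg le_rfl _
          rw [zero_mul]
          positivity
        · calc p a ^ (1 - s) * Real.log (p a) ^ 2
              ≤ p a ^ (1 - s) * (4 * M ^ 2 * Real.exp (-2) * p a ^ (-(1 / M))) := by
                gcongr
                exact log_sq_le_mul_rpow h hp1 hM
            _ = _ := by
                rw [show 1 - (s + 1 / M) = (1 - s) + -(1 / M) by ring, Real.rpow_add h]
                ring
    _ ≤ 4 * M ^ 2 * Real.exp (-2) * Real.exp M ^ (s + 1 / M) := by
        rw [← Finset.mul_sum]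
        gcongr
        exact sum_rpow_one_sub_le hp (Real.exp_pos M) hcard (by positivity) h1.le
    _ = 4 * M ^ 2 * Real.exp (s * M - 1) := by
        rw [← Real.exp_mul, mul_assoc, ← Real.exp_add]
        congr 2
        field_simp
        ring

/-- Multiply `(1 + z) (1 - z) ≤ (1 + z) exp (-z)` by `exp z`. -/
lemma exp_le_one_add_add_sq_mul_exp {z : ℝ} (hz : 0 ≤ z) :
    Real.exp z ≤ 1 + z + z ^ 2 * Real.exp z := by
  have h1 := Real.one_sub_le_exp_neg z
  have h2 : Real.exp (-z) * Real.exp z = 1 := by rw [← Real.exp_add]; simp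
  have h3 : 1 - z ^ 2 ≤ (1 + z) * Real.exp (-z) := by nlinarith
  nlinarith [Real.exp_pos z]

/-- Invert `1 + z + z²/2 ≤ exp z`, using `(1 + z + z²/2) (1 - z + z²/2) = 1 + z⁴/4 ≥ 1`. -/
lemma exp_neg_le_one_sub_add_sq {z : ℝ} (hz : 0 ≤ z) :
    Real.exp (-z) ≤ 1 - z + z ^ 2 / 2 := by
  have h1 := Real.quadratic_le_exp_of_nonneg hz
  have h2 : Real.exp (-z) * Real.exp z = 1 := by rw [← Real.exp_add]; simp
  have h3 := Real.exp_pos (-z)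
  have h4 : Real.exp (-z) * (1 + z + z ^ 2 / 2) ≤ 1 := by
    exact (mul_le_mul_of_nonneg_left h1 h3.le).trans h2.le
  have h5 : 0 < 1 - z + z ^ 2 / 2 := by nlinarith [sq_nonneg (z - 1)]
  have h6 : 1 ≤ (1 + z + z ^ 2 / 2) * (1 - z + z ^ 2 / 2) := by nlinarith [sq_nonneg (z ^ 2)]
  nlinarith

lemma rpow_one_sub_le {x s : ℝ} (hx : 0 ≤ x) (hx1 : x ≤ 1) (h0 : 0 ≤ s) (h1 : s < 1) :
    x ^ (1 - s) ≤ x + s * x.negMulLog + s ^ 2 * (x ^ (1 - s) * Real.log x ^ 2) := by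
  rcases hx.eq_or_lt with h | h
  · rw [← h, Real.zero_rpow (by linarith)]
    simp
  · have hz : 0 ≤ -(s * Real.log x) := by nlinarith [Real.log_nonpos hx hx1]
    have he : x ^ (1 - s) = x * Real.exp (-(s * Real.log x)) := by
      rw [Real.rpow_def_of_pos h, ← Real.exp_log h, Real.log_exp, ← Real.exp_add]
      congr 1; ring
    have := mul_le_mul_of_nonneg_left (exp_le_one_add_add_sq_mul_exp hz) hx
    rw [he, Real.negMulLog]
    linarith

lemma rpow_one_add_le {x s : ℝ} (hx : 0 ≤ x) (hx1 : x ≤ 1) (h0 : 0 ≤ s) :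
    x ^ (1 + s) ≤ x - s * x.negMulLog + s ^ 2 / 2 * (x * Real.log x ^ 2) := by
  rcases hx.eq_or_lt with h | h
  · rw [← h, Real.zero_rpow (by linarith)]
    simp
  · have hz : 0 ≤ -(s * Real.log x) := by nlinarith [Real.log_nonpos hx hx1]
    have he : x ^ (1 + s) = x * Real.exp (-(-(s * Real.log x))) := by
      rw [Real.rpow_def_of_pos h, ← Real.exp_log h, Real.log_exp, ← Real.exp_add]
      congr 1; ring
    have := mul_le_mul_of_nonneg_left (exp_neg_le_one_sub_add_sq hz) hx
    rw [he, Real.negMulLog]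
    linarith

/-- Gibbs' inequality against the constant weight `exp (-M)`, from `log t ≤ t - 1` at `t = exp (-M)
/ p a`. -/
lemma sum_negMulLog_le {α : Type*} [Fintype α] {p : α → ℝ} (hp : p ∈ stdSimplex ℝ α)
    {M : ℝ} (hcard : (Fintype.card α : ℝ) ≤ Real.exp M) : ∑ a, (p a).negMulLog ≤ M := by
  have hterm : ∀ a, (p a).negMulLog ≤ M * p a + (Real.exp (-M) - p a) := by
    intro a
    rcases (hp.1 a).eq_or_lt with h | h
    · rw [← h]; simp [(Real.exp_pos _).le]
    · have h1 := Real.log_le_sub_one_of_pos (x := Real.exp (-M) / p a) (by positivity)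
      rw [Real.log_div (by positivity) h.ne', Real.log_exp] at h1
      have h2 := mul_le_mul_of_nonneg_left h1 h.le
      have h3 : p a * (Real.exp (-M) / p a - 1) = Real.exp (-M) - p a := by field_simp
      rw [Real.negMulLog]
      linarith
  refine (Finset.sum_le_sum fun a _ => hterm a).trans ?_
  rw [Finset.sum_add_distrib, ← Finset.mul_sum, Finset.sum_sub_distrib, hp.2, Finset.sum_const,
    Finset.card_univ, nsmul_eq_mul]
  have := mul_le_mul_of_nonneg_right hcard (Real.exp_pos (-M)).le
  rw [← Real.exp_add, add_neg_cancel, Real.exp_zero] at this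
  linarith

/-- Crossing probabilities of product distributions decay exponentially in the entropy gap. -/
lemma crossing_prodDist_le_exp {α : Type*} [Fintype α] {p q : α → ℝ}
    (hp : p ∈ stdSimplex ℝ α) (hq : q ∈ stdSimplex ℝ α) {M η : ℝ}
    (hM : 5 / 4 ≤ M) (hcard : (Fintype.card α : ℝ) ≤ Real.exp M) (hη : 0 < η)
    (hgap : ∑ a, (p a).negMulLog + 2 * η < ∑ a, (q a).negMulLog) (n : ℕ) :
    crossing (prodDist p n) (prodDist q n) ≤ Real.exp (-(7 / 20 * (η / M) ^ 2 * n)) := by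
  have hp1 : ∀ a, p a ≤ 1 := fun a =>
    hp.2 ▸ Finset.single_le_sum (fun b _ => hp.1 b) (Finset.mem_univ a)
  have hq1 : ∀ a, q a ≤ 1 := fun a =>
    hq.2 ▸ Finset.single_le_sum (fun b _ => hq.1 b) (Finset.mem_univ a)
  have hM0 : 0 < M := by linarith
  have hHp : 0 ≤ ∑ a, (p a).negMulLog :=
    Finset.sum_nonneg fun a _ => Real.negMulLog_nonneg (hp.1 a) (hp1 a)
  have hHq := sum_negMulLog_le hq hcard
  set u : ℝ := η / M with hu
  have hηu : η = u * M := by rw [hu]; field_simp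
  have hu0 : 0 < u := by positivity
  -- The entropies lie in `[0, M]`, so the gap `2 * η` is below `M`.
  have hu1 : u ≤ 1 / 2 := by
    rw [hu, div_le_iff₀ hM0]; linarith
  -- The gain in the exponent is `2 u (s M)` and the loss at most `(4 * 0.46 + 2 * 0.37) (s M)²`, so
  -- `s M = 2 u / 5` is nearly optimal.
  set s : ℝ := 2 / 5 * u / M with hs
  have hs0 : 0 < s := by positivity
  have hsM : s * M = 2 / 5 * u := by rw [hs]; field_simp
  have hinv : 1 / M ≤ 4 / 5 := by
    rw [div_le_iff₀ hM0]; linarith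
  have hs1 : s + 1 / M < 1 := by
    have h : s = 2 / 5 * u * (1 / M) := by rw [hs]; ring
    rw [h]
    have : 0 < 1 / M := by positivity
    nlinarith
  have hslt : s < 1 := by
    have : 0 < 1 / M := by positivity
    linarith
  have hP : ∑ a, p a ^ (1 - s) ≤
      Real.exp (s * ∑ a, (p a).negMulLog + s ^ 2 * (4 * M ^ 2 * Real.exp (s * M - 1))) := by
    refine le_trans ?_ (Real.add_one_le_exp _)
    refine (Finset.sum_le_sum fun a _ => rpow_one_sub_le (hp.1 a) (hp1 a) hs0.le hslt).trans ?_
    rw [Finset.sum_add_distrib, Finset.sum_add_distrib, hp.2, ← Finset.mul_sum, ← Finset.mul_sum]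
    have := mul_le_mul_of_nonneg_left (sum_rpow_mul_log_sq_le hp hM0 hcard hs0.le hs1)
      (sq_nonneg s)
    linarith
  have hQ : ∑ a, q a ^ (1 + s) ≤
      Real.exp (-(s * ∑ a, (q a).negMulLog) + s ^ 2 / 2 * (4 * M ^ 2 * Real.exp (-1))) := by
    refine le_trans ?_ (Real.add_one_le_exp _)
    refine (Finset.sum_le_sum fun a _ => rpow_one_add_le (hq.1 a) (hq1 a) hs0.le).trans ?_
    rw [Finset.sum_add_distrib, Finset.sum_sub_distrib, hq.2, ← Finset.mul_sum, ← Finset.mul_sum]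
    have h := sum_rpow_mul_log_sq_le hq hM0 hcard le_rfl (by linarith : (0 : ℝ) + 1 / M < 1)
    simp only [sub_zero, Real.rpow_one, zero_mul, zero_sub] at h
    have := mul_le_mul_of_nonneg_left h (by positivity : 0 ≤ s ^ 2 / 2)
    linarith
  have hE1 : Real.exp (-1) ≤ 37 / 100 := by
    have := Real.exp_neg_one_lt_d9
    linarith
  have hE2 : Real.exp (s * M - 1) ≤ 23 / 50 := by
    have h1 : Real.exp (s * M) ≤ 5 / 4 := by
      rw [hsM]
      have h2 := Real.one_sub_le_exp_neg (2 / 5 * u)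
      have h3 : Real.exp (-(2 / 5 * u)) * Real.exp (2 / 5 * u) = 1 := by
        rw [← Real.exp_add]; simp
      nlinarith [Real.exp_pos (2 / 5 * u)]
    have := Real.exp_neg_one_lt_d9
    rw [sub_eq_add_neg, Real.exp_add]
    nlinarith [Real.exp_pos (s * M), Real.exp_pos (-1)]
  refine (crossing_prodDist_le hp.1 hq.1 n hs0.le).trans ?_
  rw [show -(7 / 20 * u ^ 2 * n) = (n : ℝ) * (-(7 / 20 * u ^ 2)) by ring, Real.exp_nat_mul]
  refine pow_le_pow_left₀ (mul_nonneg (Finset.sum_nonneg fun a _ => Real.rpow_nonneg (hp.1 a) _)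
    (Finset.sum_nonneg fun a _ => Real.rpow_nonneg (hq.1 a) _)) ?_ n
  refine (mul_le_mul hP hQ (Finset.sum_nonneg fun a _ => Real.rpow_nonneg (hq.1 a) _)
    (Real.exp_pos _).le).trans ?_
  rw [← Real.exp_add, Real.exp_le_exp]
  have hg := mul_le_mul_of_nonneg_left hgap.le hs0.le
  have hsη : s * (2 * η) = 4 / 5 * u ^ 2 := by
    rw [hηu]; linear_combination (2 * u) * hsM
  have hs2 : s ^ 2 * M ^ 2 = 4 / 25 * u ^ 2 := by
    rw [← mul_pow, hsM]; ring
  have e1 : s ^ 2 * (4 * M ^ 2 * Real.exp (s * M - 1)) ≤ 16 / 25 * u ^ 2 * (23 / 50) := by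
    rw [show s ^ 2 * (4 * M ^ 2 * Real.exp (s * M - 1)) =
      4 * (s ^ 2 * M ^ 2) * Real.exp (s * M - 1) by ring, hs2]
    nlinarith [sq_nonneg u]
  have e2 : s ^ 2 / 2 * (4 * M ^ 2 * Real.exp (-1)) ≤ 8 / 25 * u ^ 2 * (37 / 100) := by
    rw [show s ^ 2 / 2 * (4 * M ^ 2 * Real.exp (-1)) =
      2 * (s ^ 2 * M ^ 2) * Real.exp (-1) by ring, hs2]
    nlinarith [sq_nonneg u]
  -- The balance is `0.8 - 0.2944 - 0.1184 = 0.3872 ≥ 7/20`, in units of `u²`.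
  nlinarith [sq_nonneg u]

/-! ### Tensor powers -/

lemma sum_prod_of_apply_eq {α R : Type*} [Fintype α] [DecidableEq α] [CommSemiring R] {n : ℕ}
    (F : Fin n → α → R) (i : Fin n) (a : α) :
    ∑ x : Fin n → α with x i = a, ∏ j, F j (x j) =
      F i a * ∏ j ∈ Finset.univ.erase i, ∑ c, F j c := by
  have hset : ({x : Fin n → α | x i = a} : Finset (Fin n → α)) =
      Fintype.piFinset fun j => if j = i then {a} else Finset.univ := by
    ext x
    simp only [Finset.mem_filter, Finset.mem_univ, true_and, Fintype.mem_piFinset]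
    constructor
    · intro h j
      split_ifs with hj
      · simp [hj, h]
      · simp
    · intro h
      simpa using h i
  rw [hset, ← Finset.prod_univ_sum, ← Finset.mul_prod_erase _ _ (Finset.mem_univ i)]
  congr 1
  · simp
  · refine Finset.prod_congr rfl fun j hj => ?_
    rw [if_neg (Finset.ne_of_mem_erase hj)]

lemma tensorPower_mul {d : ℕ} (A B : Matrix (Fin d) (Fin d) ℂ) (n : ℕ) :
    tensorPower (A * B) n = tensorPower A n * tensorPower B n := by
  ext x y
  simp only [tensorPower, Matrix.mul_apply, ← Finset.prod_mul_distrib]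
  have := Finset.prod_univ_sum (fun _ : Fin n => (Finset.univ : Finset (Fin d)))
    (fun i c => A (x i) c * B c (y i))
  simpa using this

lemma tensorPower_conjTranspose {d : ℕ} (A : Matrix (Fin d) (Fin d) ℂ) (n : ℕ) :
    tensorPower Aᴴ n = (tensorPower A n)ᴴ := by
  ext x y
  simp [tensorPower, Matrix.conjTranspose_apply]

lemma tensorPower_diagonal {d : ℕ} (p : Fin d → ℝ) (n : ℕ) :
    tensorPower (Matrix.diagonal fun a => (p a : ℂ)) n =
      Matrix.diagonal fun x => (prodDist p n x : ℂ) := by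
  ext x y
  by_cases h : x = y
  · subst h
    simp [tensorPower, prodDist]
  · obtain ⟨i, hi⟩ := Function.ne_iff.1 h
    rw [Matrix.diagonal_apply_ne _ h]
    exact Finset.prod_eq_zero (Finset.mem_univ i) (Matrix.diagonal_apply_ne _ hi)

lemma tensorPower_mem_unitaryGroup {d : ℕ} {U : Matrix (Fin d) (Fin d) ℂ}
    (hU : U ∈ Matrix.unitaryGroup (Fin d) ℂ) (n : ℕ) :
    tensorPower U n ∈ Matrix.unitaryGroup (Fin n → Fin d) ℂ := by
  rw [Matrix.mem_unitaryGroup_iff, Matrix.star_eq_conjTranspose] at hU ⊢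
  rw [← tensorPower_conjTranspose, ← tensorPower_mul, hU]
  have := tensorPower_diagonal (fun _ : Fin d => 1) n
  simpa [prodDist] using this

/-! ### Spectra and the trace norm -/

/-- A state is unitarily diagonal with a probability vector as its spectrum. -/
lemma IsState.exists_spectrum {ι : Type*} [Fintype ι] [DecidableEq ι] {ρ : Matrix ι ι ℂ}
    (hρ : IsState ρ) :
    ∃ U ∈ Matrix.unitaryGroup ι ℂ, ∃ p ∈ stdSimplex ℝ ι,
      ρ = U * (Matrix.diagonal fun a => (p a : ℂ)) * Uᴴ ∧
        entropy ρ = (∑ a, (p a).negMulLog) / Real.log 2 := by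
  have hH := hρ.1.isHermitian
  have hspec : ρ = (hH.eigenvectorUnitary : Matrix ι ι ℂ) *
      (Matrix.diagonal fun a => (hH.eigenvalues a : ℂ)) *
        (hH.eigenvectorUnitary : Matrix ι ι ℂ)ᴴ := by
    conv_lhs => rw [hH.spectral_theorem, Unitary.conjStarAlgAut_apply]
    rfl
  refine ⟨hH.eigenvectorUnitary, hH.eigenvectorUnitary.2, hH.eigenvalues,
    ⟨hρ.1.eigenvalues_nonneg, ?_⟩, hspec, ?_⟩
  · have h := hH.trace_eq_sum_eigenvalues
    rw [hρ.2] at h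
    simpa using (congrArg Complex.re h).symm
  · have hU : (hH.eigenvectorUnitary : Matrix ι ι ℂ)ᴴ * hH.eigenvectorUnitary = 1 :=
      Matrix.mem_unitaryGroup_iff'.1 hH.eigenvectorUnitary.2
    have hcfc : cfc (Real.logb 2) ρ = (hH.eigenvectorUnitary : Matrix ι ι ℂ) *
        (Matrix.diagonal fun a => (Real.logb 2 (hH.eigenvalues a) : ℂ)) *
          (hH.eigenvectorUnitary : Matrix ι ι ℂ)ᴴ := by
      rw [hH.cfc_eq, Matrix.IsHermitian.cfc, Unitary.conjStarAlgAut_apply]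
      rfl
    have hprod : ρ * cfc (Real.logb 2) ρ = (hH.eigenvectorUnitary : Matrix ι ι ℂ) *
        (Matrix.diagonal fun a =>
          (hH.eigenvalues a : ℂ) * (Real.logb 2 (hH.eigenvalues a) : ℂ)) *
          (hH.eigenvectorUnitary : Matrix ι ι ℂ)ᴴ := by
      rw [hcfc]
      refine (congrArg (· * _) hspec).trans ?_
      rw [← Matrix.diagonal_mul_diagonal]
      simp only [Matrix.mul_assoc]
      rw [← Matrix.mul_assoc _ (hH.eigenvectorUnitary : Matrix ι ι ℂ), hU, Matrix.one_mul]
    rw [entropy, hprod, Matrix.trace_mul_comm, ← Matrix.mul_assoc, hU, Matrix.one_mul,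
      Matrix.trace_diagonal, Complex.re_sum, ← Finset.sum_neg_distrib, Finset.sum_div]
    refine Finset.sum_congr rfl fun a _ => ?_
    rw [← Complex.ofReal_mul, Complex.ofReal_re, Real.negMulLog, Real.logb]
    ring

/-- The trace of a function of a unitarily diagonal matrix. -/
lemma trace_cfc_conj_diagonal {ι : Type*} [Fintype ι] [DecidableEq ι] {V : Matrix ι ι ℂ}
    (hV : V ∈ Matrix.unitaryGroup ι ℂ) (c : ι → ℝ) (f : ℝ → ℝ) :
    (cfc f (V * (Matrix.diagonal fun a => (c a : ℂ)) * Vᴴ)).trace.re = ∑ a, f (c a) := by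
  have hV' : Vᴴ * V = 1 := Matrix.mem_unitaryGroup_iff'.1 hV
  have hB : (V * (Matrix.diagonal fun a => (c a : ℂ)) * Vᴴ).IsHermitian := by
    refine Matrix.isHermitian_mul_mul_conjTranspose _ ?_
    rw [Matrix.IsHermitian, Matrix.diagonal_conjTranspose]
    congr 1
    ext a
    simp
  have hU : (hB.eigenvectorUnitary : Matrix ι ι ℂ)ᴴ * hB.eigenvectorUnitary = 1 :=
    Matrix.mem_unitaryGroup_iff'.1 hB.eigenvectorUnitary.2
  -- The chosen `eigenvalues` need not be listed in the order of `c`; they agree as multisets of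
  -- roots of the characteristic polynomial.
  have hroots := hB.roots_charpoly_eq_eigenvalues
  have hchar : (V * (Matrix.diagonal fun a => (c a : ℂ)) * Vᴴ).charpoly =
      ∏ a, (Polynomial.X - Polynomial.C (c a : ℂ)) := by
    rw [Matrix.mul_assoc, Matrix.charpoly_mul_comm, Matrix.mul_assoc, hV', Matrix.mul_one,
      Matrix.charpoly_diagonal]
  rw [hchar, Polynomial.roots_prod _ _
      (Finset.prod_ne_zero_iff.2 fun a _ => Polynomial.X_sub_C_ne_zero _)] at hroots
  simp only [Polynomial.roots_X_sub_C, Multiset.bind_singleton] at hroots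
  have hsum := congrArg (fun m : Multiset ℂ => (m.map fun z => f z.re).sum) hroots
  simp only [Multiset.map_map, Function.comp_def] at hsum
  change ∑ a, f (Complex.re (c a : ℂ)) = ∑ a, f (Complex.re (hB.eigenvalues a : ℂ)) at hsum
  simp only [Complex.ofReal_re] at hsum
  rw [hsum, hB.cfc_eq, Matrix.IsHermitian.cfc, Unitary.conjStarAlgAut_apply,
    Matrix.trace_mul_comm, ← Matrix.mul_assoc, Matrix.star_eq_conjTranspose, hU, Matrix.one_mul,
    Matrix.trace_diagonal, Complex.re_sum]
  simp

lemma traceNorm_conj_diagonal {ι : Type*} [Fintype ι] [DecidableEq ι] {V : Matrix ι ι ℂ}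
    (hV : V ∈ Matrix.unitaryGroup ι ℂ) (c : ι → ℝ) :
    traceNorm (V * (Matrix.diagonal fun a => (c a : ℂ)) * Vᴴ) = ∑ a, |c a| := by
  have hV' : Vᴴ * V = 1 := Matrix.mem_unitaryGroup_iff'.1 hV
  have hsq : (V * (Matrix.diagonal fun a => (c a : ℂ)) * Vᴴ)ᴴ *
      (V * (Matrix.diagonal fun a => (c a : ℂ)) * Vᴴ) =
        V * (Matrix.diagonal fun a => ((c a ^ 2 : ℝ) : ℂ)) * Vᴴ := by
    have hd : (Matrix.diagonal fun a => ((c a ^ 2 : ℝ) : ℂ)) =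
        (Matrix.diagonal fun a => (c a : ℂ))ᴴ * Matrix.diagonal fun a => (c a : ℂ) := by
      rw [Matrix.diagonal_conjTranspose, Matrix.diagonal_mul_diagonal]
      congr 1
      ext a
      simp [sq]
    rw [hd]
    simp only [Matrix.conjTranspose_mul, Matrix.conjTranspose_conjTranspose, Matrix.mul_assoc]
    rw [← Matrix.mul_assoc Vᴴ V, hV', Matrix.one_mul]
  rw [traceNorm, hsq, trace_cfc_conj_diagonal hV]
  exact Finset.sum_congr rfl fun a _ => Real.sqrt_sq_eq_abs _

lemma conj_diagonal_apply {ι : Type*} [Fintype ι] [DecidableEq ι] (A : Matrix ι ι ℂ) (c : ι → ℂ)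
    (x y : ι) :
    (A * Matrix.diagonal c * Aᴴ) x y = ∑ z, A x z * c z * star (A y z) := by
  rw [Matrix.mul_apply]
  simp only [Matrix.mul_diagonal, Matrix.conjTranspose_apply]

/-! ### From classical to quantum majorization -/

/-- The marginals of a state that is diagonal in a product basis. -/
lemma marginal_conj_diagonal {d n : ℕ} {V : Matrix (Fin d) (Fin d) ℂ}
    (hV : V ∈ Matrix.unitaryGroup (Fin d) ℂ) (s : (Fin n → Fin d) → ℝ) (i : Fin n) :
    marginal (tensorPower V n * (Matrix.diagonal fun x => (s x : ℂ)) * (tensorPower V n)ᴴ) i =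
      V * (Matrix.diagonal fun a => ((∑ x : Fin n → Fin d with x i = a, s x : ℝ) : ℂ)) * Vᴴ := by
  have hV' : ∀ c, ∑ a, V a c * star (V a c) = 1 := by
    intro c
    have := congrFun (congrFun (Matrix.mem_unitaryGroup_iff'.1 hV) c) c
    rw [Matrix.one_apply_eq, Matrix.star_eq_conjTranspose, Matrix.mul_apply] at this
    rw [← this]
    exact Finset.sum_congr rfl fun a _ => by rw [Matrix.conjTranspose_apply, mul_comm]
  have hkey : ∀ (z : Fin n → Fin d) (a b : Fin d),
      ∑ x : Fin n → Fin d with x i = a,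
        tensorPower V n x z * star (tensorPower V n (Function.update x i b) z) =
          V a (z i) * star (V b (z i)) := by
    intro z a b
    -- The sum factors over sites; each site other than `i` contributes the squared norm of a column
    -- of `V`, which is one.
    have h := sum_prod_of_apply_eq
      (fun j c => V c (z j) * star (V (if j = i then b else c) (z j))) i a
    rw [if_pos rfl, Finset.prod_eq_one (fun j hj => by
      simp only [if_neg (Finset.ne_of_mem_erase hj)]
      exact hV' (z j)), mul_one] at h
    rw [← h]
    refine Finset.sum_congr rfl fun x _ => ?_
    rw [Finset.prod_mul_distrib]
    simp only [tensorPower, Function.update_apply, star_prod]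
  ext a b
  simp only [marginal, conj_diagonal_apply]
  rw [Finset.sum_comm]
  calc _ = ∑ z, (s z : ℂ) * (V a (z i) * star (V b (z i))) := by
        refine Finset.sum_congr rfl fun z _ => ?_
        rw [← hkey, Finset.mul_sum]
        exact Finset.sum_congr rfl fun x _ => by ring
    _ = ∑ c, ∑ z : Fin n → Fin d with z i = c, (s z : ℂ) * (V a (z i) * star (V b (z i))) :=
        (Finset.sum_fiberwise _ _ _).symm
    _ = _ := by
        refine Finset.sum_congr rfl fun c _ => ?_
        push_cast
        rw [Finset.mul_sum, Finset.sum_mul]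
        refine Finset.sum_congr rfl fun z hz => ?_
        rw [(Finset.mem_filter.1 hz).2]
        ring

/-- Doubly stochastic images of the spectrum are majorized. -/
lemma majorizes_conj_diagonal {ι : Type*} [Fintype ι] [DecidableEq ι] {U V : Matrix ι ι ℂ}
    (hU : U ∈ Matrix.unitaryGroup ι ℂ) (hV : V ∈ Matrix.unitaryGroup ι ℂ) (r : ι → ℝ)
    {D : Matrix ι ι ℝ} (hD : D ∈ doublyStochastic ℝ ι) :
    Majorizes (U * (Matrix.diagonal fun x => (r x : ℂ)) * Uᴴ)
      (V * (Matrix.diagonal fun x => ((D *ᵥ r) x : ℂ)) * Vᴴ) := by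
  -- Birkhoff: `D` is a mixture of permutations, each implemented by the unitary `V * P π * Uᴴ`.
  obtain ⟨w, hw0, hw1, hw⟩ := exists_eq_sum_perm_of_mem_doublyStochastic hD
  have hU' : Uᴴ * U = 1 := Matrix.mem_unitaryGroup_iff'.1 hU
  let P : Equiv.Perm ι → Matrix ι ι ℂ := fun π => (1 : Matrix ι ι ℂ).submatrix π id
  have hPc : ∀ (π : Equiv.Perm ι) (A : Matrix ι ι ℂ), P π * A * (P π)ᴴ = A.submatrix π π := by
    intro π A
    have h1 := Matrix.submatrix_mul_equiv (1 : Matrix ι ι ℂ) A π (Equiv.refl ι) id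
    have h2 := Matrix.submatrix_mul_equiv A (1 : Matrix ι ι ℂ) π (Equiv.refl ι) π
    simp only [Equiv.coe_refl, Matrix.submatrix_id_id, Matrix.one_mul, Matrix.mul_one] at h1 h2
    simp only [P, Matrix.conjTranspose_submatrix, Matrix.conjTranspose_one]
    rw [h1, h2]
  have hPU : ∀ π, P π ∈ Matrix.unitaryGroup ι ℂ := by
    intro π
    have := hPc π 1
    rw [Matrix.mul_one, Matrix.submatrix_one_equiv] at this
    exact Matrix.mem_unitaryGroup_iff.2 this
  have hUs : Uᴴ ∈ Matrix.unitaryGroup ι ℂ := Unitary.star_mem hU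
  let e := (Fintype.equivFin (Equiv.Perm ι)).symm
  refine ⟨Fintype.card (Equiv.Perm ι), fun k => V * P (e k) * Uᴴ, fun k => w (e k),
    fun k => mul_mem (mul_mem hV (hPU _)) hUs, fun k => hw0 _, ?_, ?_⟩
  · rw [← hw1]
    exact e.sum_comp w
  · rw [e.sum_comp (fun π => (w π : ℂ) • (V * P π * Uᴴ *
      (U * (Matrix.diagonal fun x => (r x : ℂ)) * Uᴴ) * (V * P π * Uᴴ)ᴴ))]
    have hterm : ∀ π : Equiv.Perm ι, V * P π * Uᴴ *
        (U * (Matrix.diagonal fun x => (r x : ℂ)) * Uᴴ) * (V * P π * Uᴴ)ᴴ =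
          V * (Matrix.diagonal fun x => (r (π x) : ℂ)) * Vᴴ := by
      intro π
      have h1 := hPc π (Matrix.diagonal fun x => (r x : ℂ))
      rw [Matrix.submatrix_diagonal_equiv] at h1
      have h2 : (Matrix.diagonal fun x => (r (π x) : ℂ)) =
          P π * (Matrix.diagonal fun x => (r x : ℂ)) * (P π)ᴴ := h1.symm
      rw [h2]
      simp only [Matrix.conjTranspose_mul, Matrix.conjTranspose_conjTranspose, Matrix.mul_assoc]
      rw [← Matrix.mul_assoc Uᴴ U, hU', Matrix.one_mul, ← Matrix.mul_assoc Uᴴ U, hU',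
        Matrix.one_mul]
    simp only [hterm]
    have hdiag : (Matrix.diagonal fun x => ((D *ᵥ r) x : ℂ)) =
        ∑ π : Equiv.Perm ι, (w π : ℂ) • Matrix.diagonal fun x => (r (π x) : ℂ) := by
      rw [← hw]
      ext x y
      by_cases h : x = y
      · subst h
        simp [Matrix.sum_apply, Matrix.sum_mulVec, Matrix.smul_mulVec, Matrix.permMatrix_mulVec]
      · simp [Matrix.sum_apply, h]
    rw [hdiag, Finset.mul_sum, Finset.sum_mul]
    simp

lemma sum_prodDist_of_apply_eq {α : Type*} [Fintype α] [DecidableEq α] {p : α → ℝ}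
    (hp : p ∈ stdSimplex ℝ α) {n : ℕ} (i : Fin n) (a : α) :
    ∑ x : Fin n → α with x i = a, prodDist p n x = p a := by
  simp only [prodDist]
  rw [sum_prod_of_apply_eq (fun _ c => p c) i a]
  simp [hp.2]

/-- `S_n(ρ)` comes as close to `ρ'` as the crossing probability of the product spectra. -/
lemma exists_mem_marginalSet_traceDist_le {d n : ℕ} (hn : 1 ≤ n)
    {U V : Matrix (Fin d) (Fin d) ℂ} (hU : U ∈ Matrix.unitaryGroup (Fin d) ℂ)
    (hV : V ∈ Matrix.unitaryGroup (Fin d) ℂ) {p q : Fin d → ℝ}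
    (hp : p ∈ stdSimplex ℝ (Fin d)) (hq : q ∈ stdSimplex ℝ (Fin d)) :
    ∃ τ ∈ marginalSet n (U * (Matrix.diagonal fun a => (p a : ℂ)) * Uᴴ),
      traceDist (V * (Matrix.diagonal fun a => (q a : ℂ)) * Vᴴ) τ ≤
        crossing (prodDist p n) (prodDist q n) := by
  have hr := prodDist_mem_stdSimplex hp n
  obtain ⟨D, hD, hle⟩ :=
    exists_doublyStochastic_sum_abs_sub_le hr (prodDist_mem_stdSimplex hq n)
  have hVn := tensorPower_mem_unitaryGroup hV n
  have hn0 : (n : ℝ) ≠ 0 := by positivity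
  set s := D *ᵥ prodDist p n with hs
  have hs0 : ∀ x, 0 ≤ s x := fun x => Finset.sum_nonneg fun y _ =>
    mul_nonneg (nonneg_of_mem_doublyStochastic hD) (hr.1 y)
  have hs1 : ∑ x, s x = 1 := by rw [hs, sum_mulVec_of_mem_doublyStochastic hD, hr.2]
  have hmem : (1 / (n : ℂ)) • ∑ i, marginal (tensorPower V n *
      (Matrix.diagonal fun x => (s x : ℂ)) * (tensorPower V n)ᴴ) i ∈
        marginalSet n (U * (Matrix.diagonal fun a => (p a : ℂ)) * Uᴴ) := by
    refine ⟨_, ?_, ⟨?_, ?_⟩, rfl⟩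
    · rw [tensorPower_mul, tensorPower_mul, tensorPower_conjTranspose, tensorPower_diagonal]
      exact majorizes_conj_diagonal (tensorPower_mem_unitaryGroup hU n) hVn _ hD
    · refine Matrix.PosSemidef.mul_mul_conjTranspose_same
        (Matrix.PosSemidef.diagonal fun x => ?_) _
      exact Complex.zero_le_real.2 (hs0 x)
    · have hV' : (tensorPower V n)ᴴ * tensorPower V n = 1 := Matrix.mem_unitaryGroup_iff'.1 hVn
      rw [Matrix.trace_mul_comm, ← Matrix.mul_assoc, hV', Matrix.one_mul, Matrix.trace_diagonal]
      exact_mod_cast hs1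
  refine ⟨_, hmem, ?_⟩
  simp only [marginal_conj_diagonal hV]
  -- Every one-site marginal of `q^n` is `q`, so `q` is also their average and the difference is an
  -- averaged marginal.
  have hdiff : V * (Matrix.diagonal fun a => (q a : ℂ)) * Vᴴ - (1 / (n : ℂ)) • ∑ i : Fin n,
      V * (Matrix.diagonal fun a => ((∑ x : Fin n → Fin d with x i = a, s x : ℝ) : ℂ)) * Vᴴ =
        V * (Matrix.diagonal fun a => ((1 / (n : ℝ) * ∑ i : Fin n,
          ∑ x : Fin n → Fin d with x i = a, (prodDist q n x - s x) : ℝ) : ℂ)) * Vᴴ := by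
    have hdiag : (Matrix.diagonal fun a => ((1 / (n : ℝ) * ∑ i : Fin n,
          ∑ x : Fin n → Fin d with x i = a, (prodDist q n x - s x) : ℝ) : ℂ)) =
        (Matrix.diagonal fun a => (q a : ℂ)) - (1 / (n : ℂ)) • ∑ i : Fin n,
          Matrix.diagonal fun a => ((∑ x : Fin n → Fin d with x i = a, s x : ℝ) : ℂ) := by
      ext a b
      by_cases h : a = b
      · subst h
        simp only [Finset.sum_sub_distrib, sum_prodDist_of_apply_eq hq, Matrix.sub_apply,
          Matrix.smul_apply, Matrix.sum_apply, Matrix.diagonal_apply_eq, smul_eq_mul]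
        simp only [Finset.sum_const, Finset.card_univ, Fintype.card_fin, nsmul_eq_mul]
        push_cast
        have : (n : ℂ) ≠ 0 := by exact_mod_cast hn0
        field_simp
      · simp [Matrix.sum_apply, h]
    rw [hdiag, Matrix.mul_sub, Matrix.sub_mul, Matrix.mul_smul, Matrix.smul_mul, Finset.mul_sum,
      Finset.sum_mul]
  rw [traceDist, hdiff, traceNorm_conj_diagonal hV, div_le_iff₀ two_pos, mul_comm _ (2 : ℝ)]
  refine le_trans ?_ hle
  calc ∑ a, |1 / (n : ℝ) * ∑ i : Fin n,
          ∑ x : Fin n → Fin d with x i = a, (prodDist q n x - s x)|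
      ≤ ∑ a, 1 / (n : ℝ) * ∑ i : Fin n,
          ∑ x : Fin n → Fin d with x i = a, |prodDist q n x - s x| := by
        refine Finset.sum_le_sum fun a _ => ?_
        rw [abs_mul, abs_of_nonneg (by positivity : 0 ≤ 1 / (n : ℝ))]
        gcongr
        refine (Finset.abs_sum_le_sum_abs _ _).trans (Finset.sum_le_sum fun i _ => ?_)
        exact Finset.abs_sum_le_sum_abs _ _
    -- For each site the fibres partition all `x`, so the `n` equal sums cancel `1 / n`.
    _ = ∑ x, |prodDist q n x - s x| := by
        rw [← Finset.mul_sum, Finset.sum_comm]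
        simp only [Finset.sum_fiberwise]
        rw [Finset.sum_const, Finset.card_univ, Fintype.card_fin, nsmul_eq_mul]
        field_simp

lemma traceDistToSet_le_of_crossing_le {d n : ℕ} (hn : 1 ≤ n)
    {U V : Matrix (Fin d) (Fin d) ℂ} (hU : U ∈ Matrix.unitaryGroup (Fin d) ℂ)
    (hV : V ∈ Matrix.unitaryGroup (Fin d) ℂ) {p q : Fin d → ℝ}
    (hp : p ∈ stdSimplex ℝ (Fin d)) (hq : q ∈ stdSimplex ℝ (Fin d)) {ε : ℝ}
    (hε : crossing (prodDist p n) (prodDist q n) ≤ ε) :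
    traceDistToSet (V * (Matrix.diagonal fun a => (q a : ℂ)) * Vᴴ)
      (marginalSet n (U * (Matrix.diagonal fun a => (p a : ℂ)) * Uᴴ)) ≤ ENNReal.ofReal ε := by
  obtain ⟨τ, hτ, hle⟩ := exists_mem_marginalSet_traceDist_le hn hU hV hp hq
  exact iInf₂_le_of_le τ hτ (ENNReal.ofReal_le_ofReal (hle.trans hε))

/-! ### Constants and conclusion -/

/-- The numerical comparison between the decay rate and the prescribed number of copies. -/
lemma exp_neg_le_of_ceil_le {M δ ε : ℝ} (hM : 0 < M) (hδ : 0 < δ) (hε : 0 < ε) (hε1 : ε < 1)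
    {n : ℕ} (hn : 2 * (M / Real.log 2) ^ 2 / δ ^ 2 * Real.logb 2 (1 / ε) ≤ n) :
    Real.exp (-(7 / 20 * (δ * Real.log 2 / M) ^ 2 * n)) ≤ ε := by
  have hl : 0 < Real.log 2 := Real.log_pos one_lt_two
  have hl7 := Real.log_two_lt_d9
  have hlε : 0 < -Real.log ε := neg_pos.2 (Real.log_neg hε hε1)
  rw [← Real.le_log_iff_exp_le hε, neg_le]
  have h := mul_le_mul_of_nonneg_left hn
    (by positivity : 0 ≤ 7 / 20 * (δ * Real.log 2 / M) ^ 2)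
  refine le_trans ?_ h
  have he : 7 / 20 * (δ * Real.log 2 / M) ^ 2 *
      (2 * (M / Real.log 2) ^ 2 / δ ^ 2 * Real.logb 2 (1 / ε)) =
        7 / 10 / Real.log 2 * -Real.log ε := by
    rw [one_div, Real.logb_inv, Real.logb]
    field_simp
    ring
  rw [he]
  -- The prescribed `n` uses base-2 logarithms of `1 / ε`; the rate `7/20` suffices because `log 2 <
  -- 7/10`.
  refine le_mul_of_one_le_left hlε.le ?_
  rw [le_div_iff₀ hl]
  linarith

end QTypicality

end

theorem lemma3 (d : ℕ) (δ ε : ℝ) (hδ : 0 < δ) (hε : 0 < ε) :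
    ∃ n : ℕ, 1 ≤ n ∧
      (ε < 1 → (n : ℤ) = ⌈2 * Real.logb 2 ((d : ℝ) + 3) ^ 2 / δ ^ 2 * Real.logb 2 (1 / ε)⌉) ∧
      ∀ ρ ρ' : Matrix (Fin d) (Fin d) ℂ, QTypicality.IsState ρ → QTypicality.IsState ρ' →
        QTypicality.entropy ρ + 2 * δ < QTypicality.entropy ρ' →
          QTypicality.traceDistToSet ρ' (QTypicality.marginalSet n ρ) ≤ ENNReal.ofReal ε := by
  have hl : 0 < Real.log 2 := Real.log_pos one_lt_two
  have hd0 : (0 : ℝ) ≤ d := Nat.cast_nonneg d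
  have hM0 : 0 < Real.log ((d : ℝ) + 3) := Real.log_pos (by linarith)
  rcases lt_or_ge ε 1 with hε1 | hε1
  · set t := 2 * Real.logb 2 ((d : ℝ) + 3) ^ 2 / δ ^ 2 * Real.logb 2 (1 / ε) with ht
    have ht0 : 0 < t := by
      have h1 : 0 < Real.logb 2 ((d : ℝ) + 3) := Real.logb_pos one_lt_two (by linarith)
      have h2 : 0 < Real.logb 2 (1 / ε) :=
        Real.logb_pos one_lt_two (by rw [lt_div_iff₀ hε]; linarith)
      positivity
    refine ⟨⌈t⌉₊, Nat.one_le_iff_ne_zero.2 (Nat.ceil_pos.2 ht0).ne',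
      fun _ => Int.natCast_ceil_eq_ceil ht0.le, fun ρ ρ' hρ hρ' hgap => ?_⟩
    obtain ⟨U, hU, p, hp, hρp, hHp⟩ := hρ.exists_spectrum
    obtain ⟨V, hV, q, hq, hρq, hHq⟩ := hρ'.exists_spectrum
    rw [hHp, hHq] at hgap
    rw [hρp, hρq]
    refine QTypicality.traceDistToSet_le_of_crossing_le
      (Nat.one_le_iff_ne_zero.2 (Nat.ceil_pos.2 ht0).ne') hU hV hp hq ?_
    -- There are no states in dimension zero.
    have hd : (1 : ℝ) ≤ d := by
      rcases Nat.eq_zero_or_pos d with h | h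
      · subst h
        simpa using hp.2
      · exact_mod_cast h
    -- With `d ≥ 1` the shift by `3` gives `log (d + 3) ≥ log 4 > 5/4`, which leaves room for the
    -- tilt `s + 1 / M < 1`.
    have hM : 5 / 4 ≤ Real.log ((d : ℝ) + 3) := by
      have h4 : Real.log 4 = 2 * Real.log 2 := by
        rw [show (4 : ℝ) = 2 ^ 2 by norm_num, Real.log_pow]; norm_num
      have h5 : Real.log 4 ≤ Real.log ((d : ℝ) + 3) :=
        Real.log_le_log (by norm_num) (by linarith)
      have := Real.log_two_gt_d9
      linarith
    -- The factor `log 2` in `η` converts the gap from bits to nats.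
    refine (QTypicality.crossing_prodDist_le_exp (η := δ * Real.log 2) hp hq hM ?_
      (by positivity) ?_ _).trans
        (QTypicality.exp_neg_le_of_ceil_le hM0 hδ hε hε1 (Nat.le_ceil t))
    · rw [Real.exp_log (by linarith), Fintype.card_fin]
      linarith
    · rw [← sub_pos] at hgap ⊢
      have := mul_pos hgap hl
      have he : ((∑ a, (q a).negMulLog) / Real.log 2 -
          ((∑ a, (p a).negMulLog) / Real.log 2 + 2 * δ)) * Real.log 2 =
          ∑ a, (q a).negMulLog - (∑ a, (p a).negMulLog + 2 * (δ * Real.log 2)) := by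
        field_simp
      rwa [he] at this
  -- For `ε ≥ 1` one copy suffices, since a crossing probability never exceeds one.
  · refine ⟨1, le_rfl, fun h => absurd h (not_lt.2 hε1), fun ρ ρ' hρ hρ' _ => ?_⟩
    obtain ⟨U, hU, p, hp, hρp, -⟩ := hρ.exists_spectrum
    obtain ⟨V, hV, q, hq, hρq, -⟩ := hρ'.exists_spectrum
    rw [hρp, hρq]
    exact QTypicality.traceDistToSet_le_of_crossing_le le_rfl hU hV hp hq
      ((QTypicality.crossing_le_one (QTypicality.prodDist_mem_stdSimplex hp 1)
        (QTypicality.prodDist_mem_stdSimplex hq 1)).trans hε1)
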